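/- Let $D$ be a simple directed graph (no loops, no multiple edges) on a finite vertex set $V$ with $|V|\ge 3$, and suppose that $D$ is strongly connected. Let $P$ be the transition matrix of the simple random walk on $D$, i.e. $P(u,v)=1/d^+(u)$ if $(u,v)$ is an edge and $P(u,v)=0$ otherwise, where $d^+(u)$ is the out-degree of $u$. Let $\phi$ be its (unique, positive) stationary distribution, i.e. $\phi\ge 0$, $\sum_{v}\phi(v)=1$ and $\phi P=\phi$. The principal ratio of $D$ is $$\gamma(D)=\frac{\max_{u}\phi(u)}{\min_{u}\phi(u)}.$$ For $n\ge 3$ let $$\gamma(n)=\max\{\gamma(D): D \text{ is a strongly connected simple directed graph with } n \text{ vertices}\}.$$ **Theorem.** For every $n\ge 3$ this maximum exists, and as $n\to\infty$, $$\gamma(n)=\left(\frac23+o(1)\right)(n-1)!.$$ -/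

import Mathlib

namespace Digraph

section

open scoped Matrix

/-- A digraph is loopless if no vertex is its own out-neighbour. (Multiple edges are excluded
by the type `Digraph` itself, so a loopless `Digraph` is a simple directed graph.) -/
def IsLoopless {V : Type*} (D : Digraph V) : Prop :=
  ∀ v, ¬ D.Adj v v

/-- A digraph is strongly connected if every vertex can be reached from every vertex by a
directed walk. -/
def IsStronglyConnected {V : Type*} (D : Digraph V) : Prop :=
  ∀ u v, Relation.ReflTransGen D.Adj u v

/-- The out-degree of a vertex: its number of out-neighbours. -/
noncomputable def outDegree {V : Type*} (D : Digraph V) (u : V) : ℕ :=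
  {v | D.Adj u v}.ncard

open Classical in
/-- The transition probability matrix of the simple random walk on a digraph. -/
noncomputable def transitionMatrix {V : Type*} (D : Digraph V) : Matrix V V ℝ :=
  fun u v => if D.Adj u v then 1 / (D.outDegree u : ℝ) else 0

/-- `φ` is a stationary distribution of the simple random walk on `D`: a probability
distribution on the vertices with `φ P = φ`. -/
def IsStationary {V : Type*} [Fintype V] (D : Digraph V) (φ : V → ℝ) : Prop :=
  (∀ v, 0 ≤ φ v) ∧ ∑ v, φ v = 1 ∧ φ ᵥ* D.transitionMatrix = φ

/-- The stationary distribution of the simple random walk on `D`. On a strongly connected digraph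
with at least two vertices it exists, is unique and is positive, see
`existsUnique_isStationary`, `isStationary_stationaryDistribution` and
`stationaryDistribution_pos` below; for other digraphs the value is irrelevant. -/
noncomputable def stationaryDistribution {V : Type*} [Fintype V] (D : Digraph V) : V → ℝ :=
  Classical.epsilon D.IsStationary

/-- The principal ratio: the ratio of the maximum to the minimum value of the stationary
distribution. -/
noncomputable def principalRatio {V : Type*} [Fintype V] (D : Digraph V) : ℝ :=
  (⨆ u, D.stationaryDistribution u) / (⨅ u, D.stationaryDistribution u)

/-- The set of principal ratios of all strongly connected simple digraphs on `n` vertices. -/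
def principalRatios (n : ℕ) : Set ℝ :=
  {r | ∃ D : Digraph (Fin n), D.IsLoopless ∧ D.IsStronglyConnected ∧ r = D.principalRatio}

/-- The function `γ(n)`: the maximum principal ratio of strongly connected simple digraphs on `n`
vertices, taken as a supremum. -/
noncomputable def maxPrincipalRatio (n : ℕ) : ℝ :=
  sSup (principalRatios n)

/-! The remaining facts show that the stationary distribution is well defined. -/

theorem transitionMatrix_nonneg {V : Type*} (D : Digraph V) (u v : V) :
    0 ≤ D.transitionMatrix u v := by
  unfold transitionMatrix
  split_ifs <;> positivity

theorem IsStronglyConnected.exists_adj {V : Type*} [Nontrivial V] {D : Digraph V}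
    (hD : D.IsStronglyConnected) (u : V) : ∃ v, D.Adj u v := by
  obtain ⟨w, hw⟩ := exists_ne u
  rcases Relation.ReflTransGen.cases_head (hD u w) with h | ⟨v, hv, _⟩
  · exact absurd h.symm hw
  · exact ⟨v, hv⟩

theorem IsStronglyConnected.outDegree_pos {V : Type*} [Fintype V] [Nontrivial V] {D : Digraph V}
    (hD : D.IsStronglyConnected) (u : V) : 0 < D.outDegree u := by
  obtain ⟨v, hv⟩ := hD.exists_adj u
  exact (Set.ncard_pos (Set.toFinite _)).2 ⟨v, hv⟩

theorem IsStronglyConnected.sum_transitionMatrix {V : Type*} [Fintype V] [Nontrivial V]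
    {D : Digraph V} (hD : D.IsStronglyConnected) (u : V) :
    ∑ v, D.transitionMatrix u v = 1 := by
  classical
  have h := hD.outDegree_pos u
  have hc : D.outDegree u = (Finset.univ.filter fun v => D.Adj u v).card := by
    rw [outDegree, ← Set.ncard_coe_finset]
    simp
  have h' : (D.outDegree u : ℝ) ≠ 0 := by positivity
  simp only [transitionMatrix]
  rw [← Finset.sum_filter, Finset.sum_const, ← hc, nsmul_eq_mul]
  field_simp

theorem IsStronglyConnected.sum_vecMul {V : Type*} [Fintype V] [Nontrivial V] {D : Digraph V}
    (hD : D.IsStronglyConnected) (x : V → ℝ) :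
    ∑ v, (x ᵥ* D.transitionMatrix) v = ∑ v, x v := by
  simp only [Matrix.vecMul, dotProduct]
  rw [Finset.sum_comm]
  refine Finset.sum_congr rfl fun u _ => ?_
  rw [← Finset.mul_sum, hD.sum_transitionMatrix, mul_one]

theorem IsStronglyConnected.posPart_vecMul {V : Type*} [Fintype V] [Nontrivial V] {D : Digraph V}
    (hD : D.IsStronglyConnected) {x : V → ℝ} (hx : x ᵥ* D.transitionMatrix = x) :
    (fun v => max (x v) 0) ᵥ* D.transitionMatrix = fun v => max (x v) 0 := by
  have hle : ∀ v, max (x v) 0 ≤ ((fun v => max (x v) 0) ᵥ* D.transitionMatrix) v := by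
    intro v
    refine max_le ?_ ?_
    · conv_lhs => rw [← hx]
      simp only [Matrix.vecMul, dotProduct]
      exact Finset.sum_le_sum fun u _ =>
        mul_le_mul_of_nonneg_right (le_max_left _ _) (D.transitionMatrix_nonneg u v)
    · simp only [Matrix.vecMul, dotProduct]
      exact Finset.sum_nonneg fun u _ =>
        mul_nonneg (le_max_right _ _) (D.transitionMatrix_nonneg u v)
  have hs := hD.sum_vecMul (fun v => max (x v) 0)
  funext v
  exact ((Finset.sum_eq_sum_iff_of_le fun v _ => hle v).1 hs.symm v (Finset.mem_univ v)).symm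

theorem IsStronglyConnected.pos_of_vecMul {V : Type*} [Fintype V] [Nontrivial V] {D : Digraph V}
    (hD : D.IsStronglyConnected) {x : V → ℝ} (hx : x ᵥ* D.transitionMatrix = x)
    (h0 : ∀ v, 0 ≤ x v) {u : V} (hu : 0 < x u) (v : V) : 0 < x v := by
  induction hD u v with
  | refl => exact hu
  | @tail b c _ hbc ih =>
    rw [← hx]
    simp only [Matrix.vecMul, dotProduct]
    refine Finset.sum_pos' (fun w _ => mul_nonneg (h0 w) (D.transitionMatrix_nonneg w c))
      ⟨b, Finset.mem_univ b, mul_pos ih ?_⟩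
    have := hD.outDegree_pos b
    simp only [transitionMatrix, if_pos hbc]
    positivity

/-- On a strongly connected digraph with at least two vertices, the simple random walk has exactly
one stationary distribution. -/
theorem existsUnique_isStationary {V : Type*} [Fintype V] [Nontrivial V] {D : Digraph V}
    (hD : D.IsStronglyConnected) : ∃! φ : V → ℝ, D.IsStationary φ := by
  classical
  have key : ∀ x : V → ℝ, x ᵥ* D.transitionMatrix = x → ∀ u v, 0 < x u → 0 < x v := by
    intro x hx u v hu
    have := hD.pos_of_vecMul (hD.posPart_vecMul hx) (fun v => le_max_right _ _)
      (u := u) (lt_max_of_lt_left hu) v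
    simpa using this
  have norm : ∀ x : V → ℝ, x ᵥ* D.transitionMatrix = x → ∀ u, 0 < x u →
      ∃ φ : V → ℝ, D.IsStationary φ := by
    intro x hx u hu
    have hpos : ∀ v, 0 < x v := fun v => key x hx u v hu
    have hs : 0 < ∑ v, x v := Finset.sum_pos (fun v _ => hpos v) ⟨u, Finset.mem_univ u⟩
    refine ⟨(∑ v, x v)⁻¹ • x, fun v => ?_, ?_, ?_⟩
    · have := hpos v
      simp only [Pi.smul_apply, smul_eq_mul]
      positivity
    · simp only [Pi.smul_apply, smul_eq_mul]
      rw [← Finset.mul_sum, inv_mul_cancel₀ hs.ne']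
    · rw [Matrix.smul_vecMul, hx]
  have hex : ∃ φ : V → ℝ, D.IsStationary φ := by
    have h1 : ∃ v : V → ℝ, v ≠ 0 ∧ (D.transitionMatrix - 1) *ᵥ v = 0 := by
      refine ⟨1, one_ne_zero, ?_⟩
      funext u
      simp [Matrix.mulVec, dotProduct, Matrix.one_apply, hD.sum_transitionMatrix]
    obtain ⟨x, hx0, hx⟩ := Matrix.exists_vecMul_eq_zero_iff.2
      (Matrix.exists_mulVec_eq_zero_iff.1 h1)
    rw [Matrix.vecMul_sub, Matrix.vecMul_one, sub_eq_zero] at hx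
    obtain ⟨u, hu⟩ := Function.ne_iff.1 hx0
    rcases lt_or_gt_of_ne hu with h | h
    · exact norm (-x) (by rw [Matrix.neg_vecMul, hx]) u (by simpa using h)
    · exact norm x hx u h
  obtain ⟨φ, hφ⟩ := hex
  refine ⟨φ, hφ, fun ψ hψ => ?_⟩
  have hd : (ψ - φ) ᵥ* D.transitionMatrix = ψ - φ := by
    rw [Matrix.sub_vecMul, hψ.2.2, hφ.2.2]
  have hsum : ∑ v, (ψ - φ) v = 0 := by
    simp [Finset.sum_sub_distrib, hψ.2.1, hφ.2.1]
  have hnp : ∀ u, ¬ 0 < (ψ - φ) u := by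
    intro u hu
    have : 0 < ∑ v, (ψ - φ) v :=
      Finset.sum_pos (fun v _ => key _ hd u v hu) ⟨u, Finset.mem_univ u⟩
    exact this.ne' hsum
  have hz := (Finset.sum_eq_zero_iff_of_nonpos fun v _ => not_lt.1 (hnp v)).1 hsum
  funext v
  exact sub_eq_zero.1 (hz v (Finset.mem_univ v))

theorem isStationary_stationaryDistribution {V : Type*} [Fintype V] [Nontrivial V] {D : Digraph V}
    (hD : D.IsStronglyConnected) : D.IsStationary D.stationaryDistribution :=
  Classical.epsilon_spec (existsUnique_isStationary hD).exists

theorem stationaryDistribution_pos {V : Type*} [Fintype V] [Nontrivial V] {D : Digraph V}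
    (hD : D.IsStronglyConnected) (v : V) : 0 < D.stationaryDistribution v := by
  have h := isStationary_stationaryDistribution hD
  have hs : 0 < ∑ v, D.stationaryDistribution v := by
    rw [h.2.1]; exact one_pos
  obtain ⟨u, _, hu⟩ := Finset.exists_lt_of_sum_lt (s := Finset.univ) (f := fun _ : V => (0 : ℝ))
    (g := D.stationaryDistribution) (by simpa using hs)
  exact hD.pos_of_vecMul h.2.2 h.1 hu v

end

end Digraph

/-!
The upper bound is a cut argument. Let `p 0, …, p k` be a shortest path from a vertex `u` to a
vertex `v`, let `r = n - 1 - k` be the number of vertices off this path, and let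
`x j = φ (p j) / d⁺(p j)` be the stationary flow along each edge out of `p j`. Conservation of
flow across the cut that separates `p (i + 1), …, p k` from the other `r + 1 + i` vertices gives
(`IsStationary.edge_flow_le`)

  `x i ≤ (r + 1 + i) * ∑ i < j < k, x j + φ v`.

Solving this recursion for the partial sums (`factorial_mul_sum_le`) bounds `x 0` by
`(r + 1) / (r + 2)! * ((n - 1)! + 2 (n - 2)!) * φ v`. As the path is shortest, `p 0` has at most
`r + 1` out-neighbours, so `φ u ≤ (r + 1) * x 0`. The factor `(r + 1) ^ 2 / (r + 2)!` is at most
`2 / 3`, with equality only for `r = 1`, so that `φ u / φ v ≤ 2 / 3 * ((n - 1)! + 2 (n - 2)!)`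
(`IsStationary.three_mul_le`).

The lower bound comes from the directed path `0 → 1 → ⋯ → n - 1` with all backward edges added.
There every vertex sends an edge to each vertex before it, so every edge count in the cut argument
is the largest possible one. The stationary distribution is explicit
(`fullBackwardPathWeight_vecMul`), and its ratio at the vertices `1` and `n - 1` is
`2 / 3 * (n - 1)! * n / (n - 1)`. The maximum exists because there are only finitely many digraphs
on `n` vertices.
-/

namespace Digraph

/-! ### Stationary flow -/

theorem outDegree_eq_card {V : Type*} [Fintype V] (D : Digraph V) (u : V)
    [DecidablePred (D.Adj u)] :
    D.outDegree u = (Finset.univ.filter fun v => D.Adj u v).card := by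
  rw [outDegree, ← Set.ncard_coe_finset]
  simp

theorem IsStationary.sum_mul {V : Type*} [Fintype V] {D : Digraph V} {φ : V → ℝ}
    (h : D.IsStationary φ) (v : V) : ∑ u, φ u * D.transitionMatrix u v = φ v :=
  congrFun h.2.2 v

/-- Conservation of flow: the stationary flow out of a vertex set equals the flow into it. -/
theorem IsStationary.flow_balance {V : Type*} [Fintype V] [Nontrivial V] [DecidableEq V]
    {D : Digraph V} (hD : D.IsStronglyConnected) {φ : V → ℝ} (h : D.IsStationary φ)
    (A : Finset V) :
    ∑ u ∈ A, ∑ v ∈ Aᶜ, φ u * D.transitionMatrix u v =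
      ∑ u ∈ Aᶜ, ∑ v ∈ A, φ u * D.transitionMatrix u v := by
  have h1 : ∑ v ∈ A, φ v = ∑ u ∈ A, ∑ v ∈ A, φ u * D.transitionMatrix u v +
      ∑ u ∈ Aᶜ, ∑ v ∈ A, φ u * D.transitionMatrix u v := by
    rw [Finset.sum_add_sum_compl, Finset.sum_comm]
    exact Finset.sum_congr rfl fun v _ => (h.sum_mul v).symm
  have h2 : ∑ u ∈ A, φ u = ∑ u ∈ A, ∑ v ∈ A, φ u * D.transitionMatrix u v +
      ∑ u ∈ A, ∑ v ∈ Aᶜ, φ u * D.transitionMatrix u v := by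
    rw [← Finset.sum_add_distrib]
    refine Finset.sum_congr rfl fun u _ => ?_
    rw [Finset.sum_add_sum_compl, ← Finset.mul_sum, hD.sum_transitionMatrix, mul_one]
  linarith

/-! ### Shortest paths -/

/-- `D.HasWalk k u v`: there is a directed walk with `k` edges from `u` to `v`. A walk is encoded
by a sequence of vertices, whose values past the index `k` are irrelevant. -/
def HasWalk {V : Type*} (D : Digraph V) (k : ℕ) (u v : V) : Prop :=
  ∃ p : ℕ → V, p 0 = u ∧ p k = v ∧ ∀ i < k, D.Adj (p i) (p (i + 1))

theorem HasWalk.trans {V : Type*} {D : Digraph V} {a b : ℕ} {u v w : V}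
    (h₁ : D.HasWalk a u v) (h₂ : D.HasWalk b v w) : D.HasWalk (a + b) u w := by
  obtain ⟨p, rfl, rfl, hp⟩ := h₁
  obtain ⟨q, hq0, rfl, hq⟩ := h₂
  refine ⟨fun i => if i < a then p i else q (i - a), ?_, ?_, fun i hi => ?_⟩
  · rcases Nat.eq_zero_or_pos a with rfl | ha
    · simpa using hq0
    · simp [ha]
  · simp
  · rcases lt_trichotomy (i + 1) a with h | h | h
    · simpa [h, (Nat.lt_succ_self i).trans h] using hp i (by omega)
    · subst h
      simpa [hq0] using hp i (by omega)
    · have := hq (i - a) (by omega)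
      simpa [show ¬ i < a by omega, show ¬ i + 1 < a by omega,
        show i + 1 - a = i - a + 1 by omega] using this

theorem hasWalk_one {V : Type*} {D : Digraph V} {u v : V} (h : D.Adj u v) : D.HasWalk 1 u v :=
  ⟨fun i => if i = 0 then u else v, by simp, by simp, fun i hi => by
    obtain rfl : i = 0 := by omega
    simpa using h⟩

theorem exists_hasWalk {V : Type*} {D : Digraph V} {u v : V}
    (h : Relation.ReflTransGen D.Adj u v) : ∃ k, D.HasWalk k u v := by
  induction h with
  | refl => exact ⟨0, fun _ => u, rfl, rfl, by simp⟩
  | tail _ hbc ih =>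
    obtain ⟨k, hk⟩ := ih
    exact ⟨k + 1, hk.trans (hasWalk_one hbc)⟩

/-- A walk of minimal length is a path without shortcuts. -/
theorem exists_induced_path {V : Type*} {D : Digraph V} {u v : V}
    (h : Relation.ReflTransGen D.Adj u v) :
    ∃ (k : ℕ) (p : ℕ → V), p 0 = u ∧ p k = v ∧ (∀ i < k, D.Adj (p i) (p (i + 1))) ∧
      Set.InjOn p (Set.Iic k) ∧ ∀ i j, i + 1 < j → j ≤ k → ¬ D.Adj (p i) (p j) := by
  classical
  have hex := exists_hasWalk h
  obtain ⟨p, hp0, hpk, hp⟩ := Nat.find_spec hex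
  have hmin : ∀ l, D.HasWalk l u v → Nat.find hex ≤ l := fun l hl => Nat.find_min' hex hl
  generalize Nat.find hex = k at *
  have hinit : ∀ i ≤ k, D.HasWalk i u (p i) := fun i hi =>
    ⟨p, hp0, rfl, fun j hj => hp j (by omega)⟩
  have hfinal : ∀ i ≤ k, D.HasWalk (k - i) (p i) v := fun i hi =>
    ⟨fun j => p (i + j), rfl, by simp [hi, hpk], fun j hj => hp (i + j) (by omega)⟩
  have hne : ∀ i j, i < j → j ≤ k → p i ≠ p j := fun i j hij hj he => by
    have := hmin _ ((hinit i (by omega)).trans (he ▸ hfinal j hj))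
    omega
  refine ⟨k, p, hp0, hpk, hp, fun i hi j hj he => ?_, fun i j hij hj ha => ?_⟩
  · rcases lt_trichotomy i j with hij | hij | hij
    · exact absurd he (hne i j hij hj)
    · exact hij
    · exact absurd he.symm (hne j i hij hi)
  · have := hmin _ (((hinit i (by omega)).trans (hasWalk_one ha)).trans (hfinal j hj))
    omega

/-! ### The upper bound -/

/-- The cut inequality. Removing the final segment `p (i + 1), …, p k` of a path leaves a set `A`
of `r + 1 + i` vertices. The flow along the edge from `p i` to `p (i + 1)` leaves `A`, so it is at
most the flow into `A`. For `j < k` the vertex `p j` sends at most `r + 1 + i` edges into `A`, each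
carrying `φ (p j) / d⁺(p j)`; the total flow out of the end `p k` is `φ (p k)`. -/
theorem IsStationary.edge_flow_le {V : Type*} [Fintype V] [Nontrivial V] {D : Digraph V}
    (hD : D.IsStronglyConnected) {φ : V → ℝ} (h : D.IsStationary φ) {k r : ℕ}
    (hcard : Fintype.card V = r + k + 1) {p : ℕ → V} (hinj : Set.InjOn p (Set.Iic k))
    {i : ℕ} (hi : i < k) (hadj : D.Adj (p i) (p (i + 1))) :
    φ (p i) / D.outDegree (p i) ≤
      (r + 1 + i) * ∑ j ∈ Finset.Ioo i k, φ (p j) / D.outDegree (p j) + φ (p k) := by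
  classical
  set B : Finset V := (Finset.Ioc i k).image p with hB
  have hinjB : Set.InjOn p (Finset.Ioc i k : Finset ℕ) :=
    hinj.mono fun j hj => (Finset.mem_Ioc.1 (Finset.mem_coe.1 hj)).2
  have hBcard : B.card = k - i := by
    rw [hB, Finset.card_image_of_injOn hinjB, Nat.card_Ioc]
  have hAcard : (Bᶜ.card : ℝ) = r + 1 + i := by
    rw [Finset.card_compl, hBcard, hcard, show r + k + 1 - (k - i) = r + 1 + i by omega]
    push_cast
    ring
  have hnn : ∀ u v, 0 ≤ φ u * D.transitionMatrix u v := fun u v =>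
    mul_nonneg (h.1 u) (D.transitionMatrix_nonneg u v)
  have hiA : p i ∈ Bᶜ := by
    simp only [hB, Finset.mem_compl, Finset.mem_image, Finset.mem_Ioc, not_exists, not_and]
    intro j hj he
    have := hinj (Set.mem_Iic.2 hj.2) (Set.mem_Iic.2 hi.le) he
    omega
  have hiB : p (i + 1) ∈ B := Finset.mem_image_of_mem p (by simp; omega)
  have hflow := h.flow_balance hD Bᶜ
  rw [compl_compl] at hflow
  have hout : φ (p i) / D.outDegree (p i) ≤
      ∑ u ∈ Bᶜ, ∑ v ∈ B, φ u * D.transitionMatrix u v := by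
    calc φ (p i) / D.outDegree (p i)
        = φ (p i) * D.transitionMatrix (p i) (p (i + 1)) := by
          rw [transitionMatrix, if_pos hadj, mul_one_div]
      _ ≤ ∑ v ∈ B, φ (p i) * D.transitionMatrix (p i) v :=
          Finset.single_le_sum (f := fun v => φ (p i) * D.transitionMatrix (p i) v)
            (fun v _ => hnn _ v) hiB
      _ ≤ _ := Finset.single_le_sum
            (f := fun u => ∑ v ∈ B, φ u * D.transitionMatrix u v)
            (fun u _ => Finset.sum_nonneg fun v _ => hnn u v) hiA
  have hin : ∀ u, ∑ v ∈ Bᶜ, φ u * D.transitionMatrix u v ≤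
      (r + 1 + i) * (φ u / D.outDegree u) := fun u => by
    rw [← hAcard, ← nsmul_eq_mul]
    refine Finset.sum_le_card_nsmul _ _ _ fun v _ => ?_
    rw [div_eq_mul_one_div]
    refine mul_le_mul_of_nonneg_left ?_ (h.1 u)
    unfold transitionMatrix
    split_ifs
    · exact le_rfl
    · positivity
  have hlast : ∑ v ∈ Bᶜ, φ (p k) * D.transitionMatrix (p k) v ≤ φ (p k) := by
    refine (Finset.sum_le_univ_sum_of_nonneg fun v => hnn (p k) v).trans ?_
    rw [← Finset.mul_sum, hD.sum_transitionMatrix, mul_one]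
  refine hout.trans (hflow.le.trans ?_)
  rw [hB, Finset.sum_image hinjB, ← hB, ← Finset.Ioo_insert_right hi,
    Finset.sum_insert (by simp), Finset.mul_sum, add_comm]
  exact add_le_add (Finset.sum_le_sum fun j _ => hin (p j)) hlast

/-- Along a path without shortcuts from `p 0` to `p k`, missing `r` vertices, only `p 1` and the
vertices off the path can be out-neighbours of `p 0`. -/
theorem outDegree_le_of_induced_path {V : Type*} [Fintype V] {D : Digraph V}
    (hloop : D.IsLoopless) {k r : ℕ} (hcard : Fintype.card V = r + k + 1) {p : ℕ → V}
    (hinj : Set.InjOn p (Set.Iic k)) (hk : 1 ≤ k)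
    (hind : ∀ i j, i + 1 < j → j ≤ k → ¬ D.Adj (p i) (p j)) :
    D.outDegree (p 0) ≤ r + 1 := by
  classical
  have hle : (insert 0 (Finset.Icc 2 k)).image p ⊆
      (Finset.univ.filter fun v => D.Adj (p 0) v)ᶜ := by
    intro v hv
    obtain ⟨j, hj, rfl⟩ := Finset.mem_image.1 hv
    simp only [Finset.mem_insert, Finset.mem_Icc] at hj
    simp only [Finset.mem_compl, Finset.mem_filter, Finset.mem_univ, true_and]
    rcases hj with rfl | hj
    · exact hloop _
    · exact hind 0 j (by omega) hj.2
  have hc := Finset.card_le_card hle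
  rw [Finset.card_image_of_injOn, Finset.card_insert_of_notMem (by simp), Nat.card_Icc,
    Finset.card_compl, ← outDegree_eq_card, hcard] at hc
  · omega
  · refine hinj.mono fun j hj => ?_
    simp only [Finset.coe_insert, Finset.coe_Icc, Set.mem_insert_iff, Set.mem_Icc] at hj
    simp only [Set.mem_Iic]
    omega

/-- The recursion behind the upper bound: with `T i = ∑ i < j < k, x j`, the quantity
`(r + i + 2)! * T i + 2 * (r + i + 1)! * c` is nondecreasing in `i`. The second summand absorbs the
additive term `c` of the recursion and is of smaller order than the first one. -/
theorem factorial_mul_sum_le {x : ℕ → ℝ} {c : ℝ} (hc : 0 ≤ c) {k r : ℕ}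
    (hx : ∀ i < k, x i ≤ (r + 1 + i) * ∑ j ∈ Finset.Ioo i k, x j + c) {i : ℕ}
    (hi : i + 1 < k) :
    ((r + 2).factorial : ℝ) * ∑ j ∈ Finset.Ioo 0 k, x j + 2 * (r + 1).factorial * c ≤
      (r + i + 2).factorial * ∑ j ∈ Finset.Ioo i k, x j + 2 * (r + i + 1).factorial * c := by
  induction i with
  | zero => simp
  | succ i ih =>
    refine (ih (by omega)).trans ?_
    have hsum : ∑ j ∈ Finset.Ioo i k, x j = x (i + 1) + ∑ j ∈ Finset.Ioo (i + 1) k, x j := by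
      rw [← Finset.sum_insert (by simp)]
      congr 1
      ext j
      simp only [Finset.mem_insert, Finset.mem_Ioo]
      omega
    have hxi := hx (i + 1) (by omega)
    rw [hsum]
    set S := ∑ j ∈ Finset.Ioo (i + 1) k, x j
    have h2 : ((r + (i + 1) + 2).factorial : ℝ) = (r + i + 3) * (r + i + 2).factorial := by
      rw [show r + (i + 1) + 2 = (r + i + 2) + 1 by ring, Nat.factorial_succ]
      push_cast
      ring
    have h1 : ((r + (i + 1) + 1).factorial : ℝ) = (r + i + 2).factorial := by
      rw [show r + (i + 1) + 1 = r + i + 2 by ring]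
    have h0 : ((r + i + 2).factorial : ℝ) = (r + i + 2) * (r + i + 1).factorial := by
      rw [Nat.factorial_succ (r + i + 1)]
      push_cast
      ring
    rw [h2, h1]
    have hF : (0 : ℝ) ≤ (r + i + 2).factorial := by positivity
    have hstep := mul_le_mul_of_nonneg_left hxi hF
    have habs : 2 * ((r + i + 1).factorial : ℝ) * c ≤ (r + i + 2).factorial * c := by
      refine mul_le_mul_of_nonneg_right ?_ hc
      rw [h0]
      exact mul_le_mul_of_nonneg_right
        (by linarith [Nat.cast_nonneg (α := ℝ) r, Nat.cast_nonneg (α := ℝ) i]) (by positivity)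
    push_cast at hstep
    linarith

/-- The constant `2 / 3` of the theorem: `(r + 1) ^ 2 / (r + 2)!` is largest at `r = 1`. -/
theorem three_mul_sq_le_two_mul_factorial (r : ℕ) :
    3 * (r + 1) ^ 2 ≤ 2 * (r + 2).factorial := by
  induction r with
  | zero => decide
  | succ r ih =>
    rw [show r + 1 + 2 = (r + 2) + 1 by ring, Nat.factorial_succ]
    rcases r with _ | r
    · decide
    · nlinarith [Nat.zero_le r, mul_le_mul_left ih (r + 1 + 2 + 1)]

/-- The upper bound. It holds for any two vertices, not only for a maximum and a minimum of the
stationary distribution. -/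
theorem IsStationary.three_mul_le {V : Type*} [Fintype V] [Nontrivial V] {D : Digraph V}
    (hloop : D.IsLoopless) (hD : D.IsStronglyConnected) {φ : V → ℝ} (h : D.IsStationary φ)
    {m : ℕ} (hm : 1 ≤ m) (hcard : Fintype.card V = m + 2) (u v : V) :
    3 * φ u ≤ 2 * ((m + 1).factorial + 2 * m.factorial) * φ v := by
  obtain ⟨k, p, rfl, rfl, hadj, hinj, hind⟩ := exists_induced_path (hD u v)
  have hkm : k ≤ m + 1 := by
    classical
    have := Finset.card_le_univ ((Finset.Iic k).image p)
    rw [Finset.card_image_of_injOn (by simpa using hinj), Nat.card_Iic, hcard] at this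
    omega
  obtain ⟨r, hr⟩ : ∃ r, m + 1 = r + k := ⟨m + 1 - k, by omega⟩
  have hcard' : Fintype.card V = r + k + 1 := by omega
  have hc : 0 ≤ φ (p k) := h.1 _
  have hx : ∀ i < k, φ (p i) / D.outDegree (p i) ≤
      (r + 1 + i) * ∑ j ∈ Finset.Ioo i k, φ (p j) / D.outDegree (p j) + φ (p k) :=
    fun i hi => h.edge_flow_le hD hcard' hinj hi (hadj i hi)
  have hfac : ((m + 1).factorial : ℝ) = (m + 1) * m.factorial := by
    rw [Nat.factorial_succ]; push_cast; rfl
  -- This settles `k ≤ 1`, where the recursion has no room; for `k = 1` the only edge on the path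
  -- carries at most `φ v`.
  have hsmall : 3 * ((m : ℝ) + 1) ≤ 2 * ((m + 1).factorial + 2 * m.factorial) := by
    rcases hm.eq_or_lt with rfl | hm2
    · norm_num [Nat.factorial]
    · have : 2 ≤ m.factorial := hm2.trans_le m.self_le_factorial
      have : (2 : ℝ) ≤ m.factorial := by exact_mod_cast this
      rw [hfac]
      nlinarith
  rcases Nat.eq_zero_or_pos k with rfl | hk
  · refine mul_le_mul_of_nonneg_right ?_ hc
    linarith
  have hfirst : φ (p 0) ≤ (r + 1) * (φ (p 0) / D.outDegree (p 0)) := by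
    have hd : (0 : ℝ) < D.outDegree (p 0) := by exact_mod_cast hD.outDegree_pos (p 0)
    have hd' : (D.outDegree (p 0) : ℝ) ≤ r + 1 := by
      exact_mod_cast outDegree_le_of_induced_path hloop hcard' hinj hk hind
    rw [← mul_div_assoc, le_div_iff₀ hd, mul_comm]
    exact mul_le_mul_of_nonneg_right hd' (h.1 _)
  have hx0 := hx 0 hk
  rcases Nat.lt_or_eq_of_le hk with hk2 | rfl
  swap
  · have hr' : (r : ℝ) = m := by exact_mod_cast (by omega : r = m)
    simp only [Nat.cast_zero, add_zero, zero_add,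
      show Finset.Ioo 0 1 = ∅ from rfl, Finset.sum_empty, mul_zero] at hx0
    have h1 : 3 * φ (p 0) ≤ 3 * ((m : ℝ) + 1) * φ (p 1) := by
      rw [← hr']
      nlinarith [Nat.cast_nonneg (α := ℝ) r]
    exact h1.trans (mul_le_mul_of_nonneg_right hsmall hc)
  obtain ⟨l, rfl⟩ : ∃ l, k = l + 2 := ⟨k - 2, by omega⟩
  -- The recursion is followed up to `i = k - 2` only, where the sum is the single term
  -- `x (k - 1) ≤ φ v`; one step further it would be empty and the bound would lose a factor 2.
  have hG := factorial_mul_sum_le (x := fun i => φ (p i) / D.outDegree (p i)) hc hx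
    (i := l) (by omega)
  have hlast := hx (l + 1) (by omega)
  rw [show Finset.Ioo l (l + 2) = {l + 1} by ext j; simp; omega, Finset.sum_singleton,
    show r + l + 2 = m + 1 by omega, show r + l + 1 = m by omega] at hG
  rw [show Finset.Ioo (l + 1) (l + 2) = ∅ by ext j; simp; omega, Finset.sum_empty, mul_zero,
    zero_add] at hlast
  rw [Nat.cast_zero, add_zero] at hx0
  set x0 := φ (p 0) / D.outDegree (p 0)
  set T := ∑ j ∈ Finset.Ioo 0 (l + 2), φ (p j) / D.outDegree (p j)
  set c := φ (p (l + 2))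
  have hr0 : (0 : ℝ) ≤ r := Nat.cast_nonneg r
  have hr2 : ((r + 2).factorial : ℝ) = (r + 2) * (r + 1).factorial := by
    rw [Nat.factorial_succ (r + 1)]; push_cast; ring
  have hrf : (0 : ℝ) < (r + 2).factorial := by positivity
  have hrf1 : (0 : ℝ) < (r + 1).factorial := by positivity
  have hend : ((r + 2).factorial : ℝ) * T + 2 * (r + 1).factorial * c ≤
      ((m + 1).factorial + 2 * m.factorial) * c := by
    refine hG.trans ?_
    rw [add_mul]
    gcongr
  have hstart : ((r + 2).factorial : ℝ) * x0 ≤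
      (r + 1) * (((r + 2).factorial : ℝ) * T + 2 * (r + 1).factorial * c) := by
    have h1 := mul_le_mul_of_nonneg_left hx0 hrf.le
    have h2 : ((r + 2).factorial : ℝ) * c ≤ (r + 1) * (2 * (r + 1).factorial * c) := by
      rw [hr2]
      nlinarith [mul_nonneg hr0 (mul_nonneg hrf1.le hc)]
    linarith
  have hsq : 3 * ((r : ℝ) + 1) ^ 2 ≤ 2 * (r + 2).factorial := by
    exact_mod_cast three_mul_sq_le_two_mul_factorial r
  set K : ℝ := ((m + 1).factorial + 2 * m.factorial) * c
  have hK : 0 ≤ K := by positivity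
  have key : ((r + 2).factorial : ℝ) * (3 * φ (p 0)) ≤ (r + 2).factorial * (2 * K) := by
    calc ((r + 2).factorial : ℝ) * (3 * φ (p 0))
        ≤ (r + 2).factorial * (3 * ((r + 1) * x0)) := by gcongr
      _ = 3 * (r + 1) * ((r + 2).factorial * x0) := by ring
      _ ≤ 3 * (r + 1) * ((r + 1) * K) := by
          refine mul_le_mul_of_nonneg_left (hstart.trans ?_) (by positivity)
          exact mul_le_mul_of_nonneg_left hend (by positivity)
      _ = 3 * (r + 1) ^ 2 * K := by ring
      _ ≤ 2 * (r + 2).factorial * K := by gcongr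
      _ = (r + 2).factorial * (2 * K) := by ring
  have := le_of_mul_le_mul_left key hrf
  linarith

theorem principalRatio_le {V : Type*} [Fintype V] [Nontrivial V] {D : Digraph V}
    (hloop : D.IsLoopless) (hD : D.IsStronglyConnected) {m : ℕ} (hm : 1 ≤ m)
    (hcard : Fintype.card V = m + 2) :
    D.principalRatio ≤ 2 / 3 * ((m + 1).factorial + 2 * m.factorial) := by
  obtain ⟨u, hu⟩ := exists_eq_ciSup_of_finite (f := D.stationaryDistribution)
  obtain ⟨v, hv⟩ := exists_eq_ciInf_of_finite (f := D.stationaryDistribution)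
  rw [principalRatio, ← hu, ← hv, div_le_iff₀ (stationaryDistribution_pos hD v)]
  have := (isStationary_stationaryDistribution hD).three_mul_le hloop hD hm hcard u v
  linarith

/-- The ratio of two values of any positive solution of `x P = x` is a lower bound for
the principal ratio. -/
theorem div_le_principalRatio {V : Type*} [Fintype V] [Nontrivial V] {D : Digraph V}
    (hD : D.IsStronglyConnected) {x : V → ℝ} (hx : Matrix.vecMul x D.transitionMatrix = x)
    (hpos : ∀ v, 0 < x v) (u v : V) : x u / x v ≤ D.principalRatio := by
  have hs : 0 < ∑ v, x v := Finset.sum_pos (fun v _ => hpos v) ⟨u, Finset.mem_univ u⟩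
  have hst : D.IsStationary ((∑ v, x v)⁻¹ • x) := by
    refine ⟨fun v => ?_, ?_, by rw [Matrix.smul_vecMul, hx]⟩
    · have := hpos v
      simp only [Pi.smul_apply, smul_eq_mul]
      positivity
    · simp only [Pi.smul_apply, smul_eq_mul]
      rw [← Finset.mul_sum, inv_mul_cancel₀ hs.ne']
  have heq := (existsUnique_isStationary hD).unique (isStationary_stationaryDistribution hD) hst
  have hratio : x u / x v = D.stationaryDistribution u / D.stationaryDistribution v := by
    rw [heq]
    simp only [Pi.smul_apply, smul_eq_mul]
    rw [mul_div_mul_left _ _ (inv_ne_zero hs.ne')]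
  obtain ⟨w, hw⟩ := exists_eq_ciInf_of_finite (f := D.stationaryDistribution)
  rw [hratio, principalRatio]
  refine div_le_div₀ ?_ (le_ciSup (Set.finite_range _).bddAbove u) ?_
    (ciInf_le (Set.finite_range _).bddBelow v)
  · exact (stationaryDistribution_pos hD u).le.trans (le_ciSup (Set.finite_range _).bddAbove u)
  · rw [← hw]
    exact stationaryDistribution_pos hD w

/-! ### The extremal example -/

/-- The directed path `0 → 1 → ⋯ → n - 1` together with all backward edges. -/
def fullBackwardPath (n : ℕ) : Digraph (Fin n) where
  Adj u v := v < u ∨ (v : ℕ) = u + 1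

theorem fullBackwardPath_adj {n : ℕ} {u v : Fin n} :
    (fullBackwardPath n).Adj u v ↔ v < u ∨ (v : ℕ) = u + 1 :=
  Iff.rfl

theorem fullBackwardPath_isLoopless (n : ℕ) : (fullBackwardPath n).IsLoopless := by
  intro v hv
  rcases fullBackwardPath_adj.1 hv with h | h
  · exact lt_irrefl v h
  · omega

theorem fullBackwardPath_isStronglyConnected (n : ℕ) :
    (fullBackwardPath n).IsStronglyConnected := by
  intro u v
  rcases lt_or_ge v u with h | h
  · exact .single (Or.inl h)
  · have : ∀ l : ℕ, ∀ w : Fin n, (w : ℕ) = u + l →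
        Relation.ReflTransGen (fullBackwardPath n).Adj u w := by
      intro l
      induction l with
      | zero =>
        intro w hw
        rw [Fin.ext (a := w) (b := u) (by simpa using hw)]
      | succ l ih =>
        intro w hw
        exact (ih ⟨u + l, by omega⟩ rfl).tail (Or.inr (by simp; omega))
    exact this (v - u) v (by have : (u : ℕ) ≤ v := h; omega)

theorem fullBackwardPath_outDegree {n : ℕ} {u : Fin n} (hu : (u : ℕ) + 1 < n) :
    (fullBackwardPath n).outDegree u = u + 1 := by
  classical
  have : (Finset.univ.filter fun v => (fullBackwardPath n).Adj u v) =
      insert ⟨u + 1, hu⟩ (Finset.Iio u) := by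
    ext v
    simp only [Finset.mem_filter, Finset.mem_univ, true_and, Finset.mem_insert, Finset.mem_Iio,
      fullBackwardPath_adj, Fin.ext_iff]
    tauto
  rw [outDegree_eq_card, this, Finset.card_insert_of_notMem, Fin.card_Iio]
  simp [Fin.lt_def]

theorem fullBackwardPath_outDegree_last {n : ℕ} {u : Fin n} (hu : (u : ℕ) + 1 = n) :
    (fullBackwardPath n).outDegree u = u := by
  classical
  have : (Finset.univ.filter fun v => (fullBackwardPath n).Adj u v) = Finset.Iio u := by
    ext v
    simp only [Finset.mem_filter, Finset.mem_univ, true_and, Finset.mem_Iio, fullBackwardPath_adj]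
    have := v.2
    constructor
    · rintro (h | h)
      · exact h
      · omega
    · exact Or.inl
  rw [outDegree_eq_card, this, Fin.card_Iio]

/-- The sum `∑ j ≥ i, x j` for `fullBackwardPath n`, up to normalization, where `x j` is the
stationary flow along each single edge out of `j`. The cut equations
`x i = (i + 1) * ∑ j > i, x j` for `i < n - 1` force it to be proportional to `1 / (i + 1)!`. -/
noncomputable def tailFlow (n i : ℕ) : ℝ :=
  if i < n then ((i + 1).factorial : ℝ)⁻¹ else 0

/-- The stationary distribution of `fullBackwardPath n` up to normalization: the out-degree times
the flow along each outgoing edge. -/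
noncomputable def fullBackwardPathWeight (n : ℕ) (u : Fin n) : ℝ :=
  (fullBackwardPath n).outDegree u * (tailFlow n u - tailFlow n (u + 1))

theorem tailFlow_sub_pos {n i : ℕ} (hi : i < n) :
    0 < tailFlow n i - tailFlow n (i + 1) := by
  unfold tailFlow
  rw [if_pos hi]
  split_ifs
  · rw [sub_pos]
    refine inv_strictAnti₀ (by positivity) ?_
    exact_mod_cast (Nat.factorial_lt (by omega)).2 (by omega)
  · rw [sub_zero]
    positivity

/-- The sum telescopes, as `tailFlow n n = 0`. -/
theorem sum_tailFlow_sub (n i : ℕ) (hi : i < n) :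
    ∑ j ∈ Finset.range n, (if i < j then tailFlow n j - tailFlow n (j + 1) else 0) =
      tailFlow n (i + 1) := by
  rw [← Finset.sum_filter, show (Finset.range n).filter (i < ·) = Finset.Ico (i + 1) n by
    ext j; simp; omega, ← neg_inj, ← Finset.sum_neg_distrib]
  simp only [neg_sub]
  rw [Finset.sum_Ico_sub _ hi]
  simp [tailFlow]

theorem fullBackwardPathWeight_vecMul {n : ℕ} (hn : 2 ≤ n) :
    Matrix.vecMul (fullBackwardPathWeight n) (fullBackwardPath n).transitionMatrix =
      fullBackwardPathWeight n := by
  classical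
  have : Nontrivial (Fin n) := Fin.nontrivial_iff_two_le.2 hn
  funext v
  -- The inflow at `v` comes from the backward edges out of all later vertices and from the
  -- forward edge out of the preceding vertex, if there is one.
  have hterm : ∀ u : Fin n, fullBackwardPathWeight n u * (fullBackwardPath n).transitionMatrix u v =
      (fun j : ℕ => (if (v : ℕ) < j then tailFlow n j - tailFlow n (j + 1) else 0) +
        if (v : ℕ) = j + 1 then tailFlow n j - tailFlow n (j + 1) else 0) u := by
    intro u
    have hd : ((fullBackwardPath n).outDegree u : ℝ) ≠ 0 := by
      exact_mod_cast ((fullBackwardPath_isStronglyConnected n).outDegree_pos u).ne'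
    simp only [fullBackwardPathWeight, transitionMatrix, fullBackwardPath_adj, Fin.lt_def]
    by_cases h1 : (v : ℕ) < u
    · rw [if_pos (Or.inl h1), if_pos h1, if_neg (by omega)]
      field_simp
      ring
    · by_cases h2 : (v : ℕ) = u + 1
      · rw [if_pos (Or.inr h2), if_neg h1, if_pos h2]
        field_simp
        ring
      · rw [if_neg (by tauto), if_neg h1, if_neg h2]
        ring
  simp only [Matrix.vecMul, dotProduct]
  rw [Finset.sum_congr rfl fun u _ => hterm u, Fin.sum_univ_eq_sum_range
    (fun j : ℕ => (if (v : ℕ) < j then tailFlow n j - tailFlow n (j + 1) else 0) +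
      if (v : ℕ) = j + 1 then tailFlow n j - tailFlow n (j + 1) else 0), Finset.sum_add_distrib,
    sum_tailFlow_sub n v v.2]
  obtain ⟨i, hi⟩ := v
  simp only [fullBackwardPathWeight]
  have hfirst : ∑ j ∈ Finset.range n, (if i = j + 1 then tailFlow n j - tailFlow n (j + 1) else 0) =
      if i = 0 then 0 else tailFlow n (i - 1) - tailFlow n i := by
    rcases i with _ | i
    · simp
    · simp only [Nat.add_right_cancel_iff]
      rw [Finset.sum_ite_eq, if_pos (by simp; omega)]
      simp
  rw [hfirst]
  have hfac : ∀ j : ℕ, ((j + 1).factorial : ℝ) = (j + 1) * j.factorial := fun j => by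
    rw [Nat.factorial_succ]; push_cast; rfl
  rcases (show i + 1 ≤ n from hi).lt_or_eq with h | h
  · rw [fullBackwardPath_outDegree (by exact h)]
    simp only [tailFlow, if_pos hi, if_pos h]
    rcases i with _ | i
    · norm_num [Nat.factorial]
    · simp only [Nat.add_sub_cancel, show i < n by omega, if_true, if_false, hfac, add_eq_zero,
        one_ne_zero, and_false]
      push_cast
      field_simp
      ring
  · subst h
    rw [fullBackwardPath_outDegree_last rfl]
    obtain ⟨i, rfl⟩ : ∃ l, i = l + 1 := ⟨i - 1, by omega⟩
    simp only [tailFlow, Nat.add_sub_cancel, if_pos hi, show i < i + 1 + 1 by omega, lt_irrefl,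
      if_false, if_true, add_eq_zero, one_ne_zero, and_false, hfac]
    push_cast
    field_simp
    ring

theorem le_principalRatio_fullBackwardPath {n : ℕ} (hn : 3 ≤ n) :
    2 / 3 * ((n - 1).factorial : ℝ) ≤ (fullBackwardPath n).principalRatio := by
  obtain ⟨m, rfl⟩ : ∃ m, n = m + 3 := ⟨n - 3, by omega⟩
  have : Nontrivial (Fin (m + 3)) := Fin.nontrivial_iff_two_le.2 (by omega)
  have hD := fullBackwardPath_isStronglyConnected (m + 3)
  have hpos : ∀ v, 0 < fullBackwardPathWeight (m + 3) v := fun v =>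
    mul_pos (by exact_mod_cast hD.outDegree_pos v) (tailFlow_sub_pos v.2)
  refine le_trans ?_ (div_le_principalRatio hD (fullBackwardPathWeight_vecMul (by omega)) hpos
    ⟨1, by omega⟩ ⟨m + 2, by omega⟩)
  have h1 : fullBackwardPathWeight (m + 3) ⟨1, by omega⟩ = 2 / 3 := by
    rw [fullBackwardPathWeight, fullBackwardPath_outDegree (by simp)]
    norm_num [tailFlow, Nat.factorial]
  have h2 : fullBackwardPathWeight (m + 3) ⟨m + 2, by omega⟩ =
      (m + 2) / ((m + 3) * (m + 2).factorial) := by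
    rw [fullBackwardPathWeight, fullBackwardPath_outDegree_last (by simp)]
    simp only [tailFlow, show m + 2 < m + 3 by omega, if_true,
      show ¬ m + 2 + 1 < m + 3 by omega, if_false, Nat.factorial_succ (m + 2)]
    push_cast
    field_simp
    ring
  have hf : (0 : ℝ) < (m + 2).factorial := by positivity
  rw [h1, h2, show m + 3 - 1 = m + 2 by omega, div_div_eq_mul_div, le_div_iff₀ (by positivity)]
  nlinarith

/-! ### The extremal value -/

theorem principalRatios_finite (n : ℕ) : (principalRatios n).Finite := by
  classical
  have hinj : Function.Injective fun (D : Digraph (Fin n)) => D.Adj := fun D D' h => by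
    cases D
    cases D'
    simpa using h
  have : Finite (Digraph (Fin n)) := Finite.of_injective _ hinj
  refine (Set.finite_range fun D : Digraph (Fin n) => D.principalRatio).subset ?_
  rintro r ⟨D, _, _, rfl⟩
  exact ⟨D, rfl⟩

theorem isGreatest_maxPrincipalRatio (n : ℕ) :
    IsGreatest (principalRatios n) (maxPrincipalRatio n) := by
  have hne : (principalRatios n).Nonempty := ⟨_, fullBackwardPath n,
    fullBackwardPath_isLoopless n, fullBackwardPath_isStronglyConnected n, rfl⟩
  exact ⟨hne.csSup_mem (principalRatios_finite n),
    fun r hr => le_csSup (principalRatios_finite n).bddAbove hr⟩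

theorem le_maxPrincipalRatio {n : ℕ} (hn : 3 ≤ n) :
    2 / 3 * ((n - 1).factorial : ℝ) ≤ maxPrincipalRatio n :=
  (le_principalRatio_fullBackwardPath hn).trans ((isGreatest_maxPrincipalRatio n).2
    ⟨_, fullBackwardPath_isLoopless n, fullBackwardPath_isStronglyConnected n, rfl⟩)

theorem maxPrincipalRatio_le {n : ℕ} (hn : 3 ≤ n) :
    maxPrincipalRatio n ≤ (2 / 3 + 4 / 3 / ((n - 1 : ℕ) : ℝ)) * (n - 1).factorial := by
  obtain ⟨m, rfl⟩ : ∃ m, n = m + 2 := ⟨n - 2, by omega⟩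
  have : Nontrivial (Fin (m + 2)) := Fin.nontrivial_iff_two_le.2 (by omega)
  obtain ⟨D, hloop, hD, hr⟩ := (isGreatest_maxPrincipalRatio (m + 2)).1
  rw [hr]
  refine (principalRatio_le hloop hD (m := m) (by omega) (by simp)).trans_eq ?_
  rw [show m + 2 - 1 = m + 1 by omega, Nat.factorial_succ]
  push_cast
  field_simp
  ring

end Digraph

theorem theorem1 :
    (∀ n : ℕ, 3 ≤ n → IsGreatest (Digraph.principalRatios n) (Digraph.maxPrincipalRatio n)) ∧
    ∃ ε : ℕ → ℝ, Filter.Tendsto ε Filter.atTop (nhds 0) ∧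
      ∀ n : ℕ, 3 ≤ n →
        Digraph.maxPrincipalRatio n = (2 / 3 + ε n) * (Nat.factorial (n - 1) : ℝ) := by
  refine ⟨fun n _ => Digraph.isGreatest_maxPrincipalRatio n,
    fun n => Digraph.maxPrincipalRatio n / (n - 1).factorial - 2 / 3, ?_, fun n _ => ?_⟩
  · have hlim : Filter.Tendsto (fun n : ℕ => 4 / 3 / ((n - 1 : ℕ) : ℝ)) Filter.atTop (nhds 0) :=
      (tendsto_const_div_atTop_nhds_zero_nat (4 / 3 : ℝ)).comp (Filter.tendsto_sub_atTop_nat 1)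
    refine tendsto_of_tendsto_of_tendsto_of_le_of_le' tendsto_const_nhds hlim ?_ ?_
    · filter_upwards [Filter.eventually_ge_atTop 3] with n hn
      have hf : (0 : ℝ) < (n - 1).factorial := by positivity
      rw [sub_nonneg, le_div_iff₀ hf]
      exact Digraph.le_maxPrincipalRatio hn
    · filter_upwards [Filter.eventually_ge_atTop 3] with n hn
      have hf : (0 : ℝ) < (n - 1).factorial := by positivity
      rw [sub_le_iff_le_add', div_le_iff₀ hf]
      exact Digraph.maxPrincipalRatio_le hn
  · have hf : ((n - 1).factorial : ℝ) ≠ 0 := by positivity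
    field_simp
    ring
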